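/- Let $L$ be a completely regular frame, that is, a complete lattice satisfying $a\wedge\bigvee S=\bigvee\{a\wedge s\mid s\in S\}$ for all $a\in L$, $S\subseteq L$, in which every element $a$ is the join of the elements completely below it. (Here $x$ is \emph{rather below} $y$, written $x\prec y$, if there is $t\in L$ with $x\wedge t=0$ and $t\vee y=1$; and $x$ is \emph{completely below} $y$ if there are $c_q\in L$, $q\in\mathbb{Q}\cap[0,1]$, with $c_0=x$, $c_1=y$ and $c_r\prec c_s$ whenever $r<s$.) Let $\mathcal{R}L$ be the commutative ring of real-valued continuous functions on $L$, i.e. of frame homomorphisms $\varphi$ from the frame of reals $\mathcal{L}(\mathbb{R})$ to $L$, and for $\varphi\in\mathcal{R}L$ put $$\operatorname{coz}\varphi=\bigvee\{\varphi(p,0)\vee\varphi(0,q)\mid p,q\in\mathbb{Q}\}.$$ Elements of $L$ of the form $\operatorname{coz}\varphi$ are called cozero elements. An ideal $I$ of $\mathcal{R}L$ is a \emph{$z$-ideal} if $\alpha\in\mathcal{R}L$, $\varphi\in I$ and $\operatorname{coz}\alpha=\operatorname{coz}\varphi$ imply $\alpha\in I$. The frame $L$ is a \emph{$P_F$-frame}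 if, whenever $a,b$ are cozero elements of $L$ with $a\wedge b=0$, at least one of $a,b$ is complemented in $L$. Then the following statements are equivalent. \begin{enumerate} \item[(1)] Of any two ideals of $\mathcal{R}L$ whose sum is a proper $z$-ideal, at least one is a $z$-ideal. \item[(2)] $L$ is a $P_F$-frame. \item[(3)] Of any two ideals of $\mathcal{R}L$ whose intersection is a $z$-ideal, at least one is a $z$-ideal. \end{enumerate} -/

import Mathlib

open TopologicalSpace

namespace PointFree

universe u

/-! ### Completely regular frames -/

section Frames

variable {L : Type u} [Order.Frame L]

/-- `a` is rather below `b`: some `t` satisfies `a ∧ t = 0` and `t ∨ b = 1`. -/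
def RatherBelow (a b : L) : Prop :=
  ∃ t : L, a ⊓ t = ⊥ ∧ t ⊔ b = ⊤

/-- `a` is completely below `b`: there is a family `c`, indexed by the rationals of `[0, 1]`,
from `a` to `b` with `c r` rather below `c s` whenever `r < s`. -/
def CompletelyBelow (a b : L) : Prop :=
  ∃ c : Set.Icc (0 : ℚ) 1 → L, c 0 = a ∧ c 1 = b ∧ ∀ r s, r < s → RatherBelow (c r) (c s)

variable (L) in
/-- Complete regularity: every element is the join of the elements completely below it. -/
def IsCompletelyRegular : Prop :=
  ∀ a : L, a = sSup {x : L | CompletelyBelow x a}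

end Frames

/-! ### The frame of reals and real-valued continuous functions on a frame -/

/-- The open interval `(a, b)` as an open set of reals. -/
def ioo (a b : ℝ) : Opens ℝ := ⟨Set.Ioo a b, isOpen_Ioo⟩

/-- The underlying set of `ℛL`: frame homomorphisms from the frame of reals to `L`.
The frame of reals is realised as the frame of open sets of `ℝ`; the theorems
`realRelations_ioo` and `existsUnique_of_relations` below show that this frame, with the
generators `(p, q)` interpreted as rational open intervals, has the universal property of the usual
presentation of the frame of reals by generators and relations. -/
abbrev RealFun (L : Type u) [Order.Frame L] : Type u := FrameHom (Opens ℝ) L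

section Presentation

variable {L : Type u} [Order.Frame L]

/-- The defining relations of the frame of reals, for an interpretation `ρ` in `L` of the
generators `(p, q)` with `p q : ℚ`. -/
structure RealRelations (ρ : ℚ → ℚ → L) : Prop where
  inf_eq : ∀ p q r s, ρ p q ⊓ ρ r s = ρ (max p r) (min q s)
  sup_eq : ∀ p q r s, p ≤ r → r < q → q ≤ s → ρ p q ⊔ ρ r s = ρ p s
  eq_sSup : ∀ p q, ρ p q = sSup {x | ∃ r s, p < r ∧ r < s ∧ s < q ∧ x = ρ r s}
  top_eq : (⊤ : L) = ⨆ (p : ℚ) (q : ℚ), ρ p q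

theorem RealRelations.eq_bot {ρ : ℚ → ℚ → L} (h : RealRelations ρ) {p q : ℚ} (hpq : q ≤ p) :
    ρ p q = ⊥ := by
  rw [h.eq_sSup, sSup_eq_bot]
  rintro x ⟨r, s, h1, h2, h3, -⟩
  linarith

theorem RealRelations.mono {ρ : ℚ → ℚ → L} (h : RealRelations ρ) {p q r s : ℚ}
    (hsub : ioo r s ≤ ioo p q) : ρ r s ≤ ρ p q := by
  rcases le_or_gt s r with hrs | hrs
  · rw [h.eq_bot hrs]; exact bot_le
  · have h1 : Set.Ioo (r : ℝ) s ⊆ Set.Ioo (p : ℝ) q := hsub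
    rw [Set.Ioo_subset_Ioo_iff (by exact_mod_cast hrs)] at h1
    have h2 : p ≤ r := by exact_mod_cast h1.1
    have h3 : s ≤ q := by exact_mod_cast h1.2
    rw [← inf_eq_right, h.inf_eq, max_eq_right h2, min_eq_right h3]

theorem RealRelations.le_of_cover {ρ : ℚ → ℚ → L} (h : RealRelations ρ) (𝒰 : Set (Opens ℝ))
    (B : L) (hB : ∀ U ∈ 𝒰, ∀ p q : ℚ, ioo p q ≤ U → ρ p q ≤ B) (p q : ℚ)
    (hpq : ioo p q ≤ sSup 𝒰) : ρ p q ≤ B := by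
  rw [h.eq_sSup]
  refine sSup_le ?_
  rintro x ⟨r, s, hpr, hrs, hsq, rfl⟩
  obtain ⟨δ, hδ, hcov⟩ := lebesgue_number_lemma_of_metric (s := Set.Icc (r : ℝ) s)
    (c := fun U : 𝒰 => ((U : Opens ℝ) : Set ℝ)) isCompact_Icc (fun U => U.1.2) (by
      intro x hx
      have hx' : x ∈ sSup 𝒰 := hpq
        ⟨lt_of_lt_of_le (by exact_mod_cast hpr) hx.1, lt_of_le_of_lt hx.2 (by exact_mod_cast hsq)⟩
      obtain ⟨U, hU, hxU⟩ := Opens.mem_sSup.1 hx'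
      exact Set.mem_iUnion.2 ⟨⟨U, hU⟩, hxU⟩)
  obtain ⟨ε, hε0, hεδ⟩ := exists_rat_btwn hδ
  have hε : (0 : ℚ) < ε := by exact_mod_cast hε0
  have small : ∀ x ∈ Set.Icc r s, ρ (x - ε) (x + ε) ≤ B := by
    intro x hx
    obtain ⟨U, hU⟩ := hcov x ⟨by exact_mod_cast hx.1, by exact_mod_cast hx.2⟩
    refine hB U.1 U.2 _ _ ?_
    intro y hy
    apply hU
    have hy' : ((x - ε : ℚ) : ℝ) < y ∧ y < ((x + ε : ℚ) : ℝ) := hy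
    push_cast at hy'
    rw [Metric.mem_ball, Real.dist_eq, abs_lt]
    constructor <;> linarith [hy'.1, hy'.2]
  have step : ∀ n : ℕ, r + n * ε ≤ s → ρ (r - ε) (r + n * ε + ε) ≤ B := by
    intro n
    induction n with
    | zero =>
      intro _
      simpa using small r ⟨le_rfl, hrs.le⟩
    | succ n ih =>
      intro hn
      push_cast at hn ⊢
      have hn0 : (0 : ℚ) ≤ n * ε := by positivity
      have h1 := ih (by linarith)
      have h2 := small (r + (n + 1) * ε) ⟨by linarith, hn⟩
      have h3 : ρ (r + (n + 1) * ε - ε - ε / 2) (r + (n + 1) * ε + ε) ≤ B := by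
        rw [← h.sup_eq (r + (n + 1) * ε - ε - ε / 2) (r + n * ε + ε / 2)
          (r + (n + 1) * ε - ε) _ (by linarith) (by linarith) (by linarith)]
        refine sup_le ((h.mono ?_).trans (small (r + n * ε) ⟨by linarith, by linarith⟩)) h2
        exact Set.Ioo_subset_Ioo (Rat.cast_le.2 (by linarith)) (Rat.cast_le.2 (by linarith))
      rw [← h.sup_eq (r - ε) (r + n * ε + ε) (r + (n + 1) * ε - ε - ε / 2) _
        (by linarith) (by linarith) (by linarith)]
      exact sup_le h1 h3
  obtain ⟨N, hN⟩ := exists_nat_gt ((s - r) / ε)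
  have hN' : s < r + N * ε := by
    have := (div_lt_iff₀ hε).1 hN
    linarith
  classical
  have hex : ∃ n : ℕ, s < r + n * ε := ⟨N, hN'⟩
  obtain ⟨m, hm⟩ : ∃ m, Nat.find hex = m + 1 := by
    refine Nat.exists_eq_succ_of_ne_zero ?_
    intro h0
    have := Nat.find_spec hex
    rw [h0] at this
    norm_num at this
    linarith
  have hm1 : s < r + (m + 1) * ε := by
    have := Nat.find_spec hex
    rw [hm] at this
    exact_mod_cast this
  have hm2 : r + m * ε ≤ s := not_lt.1 (Nat.find_min hex (by omega))
  refine (h.mono ?_).trans (step m hm2)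
  exact Set.Ioo_subset_Ioo (Rat.cast_le.2 (by linarith)) (Rat.cast_le.2 (by linarith))

theorem eq_sSup_ioo (U : Opens ℝ) :
    U = sSup {V | ∃ p q : ℚ, ioo p q ≤ U ∧ V = ioo p q} := by
  apply le_antisymm
  · intro x hx
    obtain ⟨a, b, hab, hsub⟩ := (mem_nhds_iff_exists_Ioo_subset).1 (U.2.mem_nhds hx)
    obtain ⟨p, hp1, hp2⟩ := exists_rat_btwn hab.1
    obtain ⟨q, hq1, hq2⟩ := exists_rat_btwn hab.2
    refine Opens.mem_sSup.2 ⟨ioo p q, ⟨p, q, ?_, rfl⟩, ⟨hp2, hq1⟩⟩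
    exact (Set.Ioo_subset_Ioo hp1.le hq2.le).trans hsub
  · refine sSup_le ?_
    rintro V ⟨p, q, h, rfl⟩
    exact h

/-- The rational open intervals satisfy the defining relations of the frame of reals. -/
theorem realRelations_ioo : RealRelations (fun p q : ℚ => ioo p q) where
  inf_eq p q r s := by
    ext x
    change (_ ∧ _) ∧ (_ ∧ _) ↔ _ ∧ _
    push_cast
    rw [max_lt_iff, lt_min_iff]
    tauto
  sup_eq p q r s h1 h2 h3 := by
    have h1' : (p : ℝ) ≤ r := by exact_mod_cast h1
    have h2' : (r : ℝ) < q := by exact_mod_cast h2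
    have h3' : (q : ℝ) ≤ s := by exact_mod_cast h3
    ext x
    change (_ ∧ _) ∨ (_ ∧ _) ↔ _ ∧ _
    constructor
    · rintro (⟨h4, h5⟩ | ⟨h4, h5⟩) <;> constructor <;> linarith
    · rintro ⟨h4, h5⟩
      rcases lt_or_ge x q with h6 | h6
      · exact Or.inl ⟨h4, h6⟩
      · exact Or.inr ⟨by linarith, h5⟩
  eq_sSup p q := by
    refine le_antisymm ?_ (sSup_le ?_)
    · intro x hx
      obtain ⟨r, hr1, hr2⟩ := exists_rat_btwn hx.1
      obtain ⟨s, hs1, hs2⟩ := exists_rat_btwn hx.2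
      exact Opens.mem_sSup.2 ⟨ioo r s, ⟨r, s, by exact_mod_cast hr1,
        by exact_mod_cast hr2.trans hs1, by exact_mod_cast hs2, rfl⟩, ⟨hr2, hs1⟩⟩
    · rintro _ ⟨r, s, h1, -, h3, rfl⟩
      exact Set.Ioo_subset_Ioo (Rat.cast_le.2 h1.le) (Rat.cast_le.2 h3.le)
  top_eq := by
    refine le_antisymm ?_ le_top
    intro x _
    obtain ⟨r, hr⟩ := exists_rat_lt x
    obtain ⟨s, hs⟩ := exists_rat_gt x
    exact Opens.mem_iSup.2 ⟨r, Opens.mem_iSup.2 ⟨s, ⟨hr, hs⟩⟩⟩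

/-- The open sets of `ℝ` form the frame of reals: every interpretation of the generators
`(p, q)` that satisfies the defining relations comes from exactly one frame homomorphism. -/
theorem existsUnique_of_relations (ρ : ℚ → ℚ → L) (h : RealRelations ρ) :
    ∃! φ : RealFun L, ∀ p q : ℚ, φ (ioo p q) = ρ p q := by
  let F : Opens ℝ → L := fun U => sSup {x | ∃ p q : ℚ, ioo p q ≤ U ∧ x = ρ p q}
  have hmem : ∀ {U : Opens ℝ} {p q : ℚ}, ioo p q ≤ U → ρ p q ≤ F U :=
    fun {U p q} hU => le_sSup ⟨p, q, hU, rfl⟩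
  have hmono : ∀ {U V : Opens ℝ}, U ≤ V → F U ≤ F V := by
    intro U V hUV
    refine sSup_le ?_
    rintro x ⟨p, q, hx, rfl⟩
    exact hmem (hx.trans hUV)
  let φ : RealFun L :=
    { toFun := F
      map_inf' := by
        intro U V
        refine le_antisymm (le_inf (hmono inf_le_left) (hmono inf_le_right)) ?_
        change sSup _ ⊓ sSup _ ≤ _
        rw [sSup_inf_sSup]
        refine iSup₂_le ?_
        rintro ⟨x, y⟩ ⟨⟨p, q, hx, hx'⟩, ⟨r, s, hy, hy'⟩⟩
        simp only at hx' hy'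
        subst hx' hy'
        simp only
        rw [h.inf_eq]
        refine hmem ?_
        intro z hz
        have hz' : ((max p r : ℚ) : ℝ) < z ∧ z < ((min q s : ℚ) : ℝ) := hz
        push_cast at hz'
        rw [max_lt_iff, lt_min_iff] at hz'
        exact ⟨hx ⟨hz'.1.1, hz'.2.1⟩, hy ⟨hz'.1.2, hz'.2.2⟩⟩
      map_top' := by
        refine top_le_iff.1 ?_
        rw [h.top_eq]
        exact iSup₂_le fun p q => hmem le_top
      map_sSup' := by
        intro 𝒰
        refine le_antisymm ?_ ?_
        · refine sSup_le ?_
          rintro x ⟨p, q, hx, rfl⟩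
          refine h.le_of_cover 𝒰 _ ?_ p q hx
          intro U hU r s hrs
          exact (hmem hrs).trans (le_sSup ⟨U, hU, rfl⟩)
        · refine sSup_le ?_
          rintro x ⟨U, hU, rfl⟩
          exact hmono (le_sSup hU) }
  refine ⟨φ, ?_, ?_⟩
  · intro p q
    refine le_antisymm ?_ (hmem le_rfl)
    refine sSup_le ?_
    rintro x ⟨r, s, hrs, rfl⟩
    exact h.mono hrs
  · intro ψ hψ
    ext U
    change ψ U = sSup _
    conv_lhs => rw [eq_sSup_ioo U]
    rw [map_sSup]
    congr 1
    ext x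
    constructor
    · rintro ⟨V, ⟨p, q, hV, rfl⟩, rfl⟩
      exact ⟨p, q, hV, hψ p q⟩
    · rintro ⟨p, q, hV, rfl⟩
      exact ⟨_, ⟨p, q, hV, rfl⟩, hψ p q⟩

end Presentation

/-! ### The ring structure of `ℛL` -/

section Pairing

variable {L : Type u} [Order.Frame L]
variable {X Y Z : Type*} [TopologicalSpace X] [TopologicalSpace Y] [TopologicalSpace Z]

/-- The open box `V × W`. -/
def box (V : Opens X) (W : Opens Y) : Opens (X × Y) :=
  ⟨(V : Set X) ×ˢ (W : Set Y), V.2.prod W.2⟩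

/-- The value at `U` of the homomorphism induced by `φ` and `ψ` on the opens of the product:
the join of all `φ V ∧ ψ W` with `V × W ⊆ U`. -/
def pairFun (φ : FrameHom (Opens X) L) (ψ : FrameHom (Opens Y) L) (U : Opens (X × Y)) : L :=
  sSup {x | ∃ (V : Opens X) (W : Opens Y), box V W ≤ U ∧ x = φ V ⊓ ψ W}

theorem le_pairFun (φ : FrameHom (Opens X) L) (ψ : FrameHom (Opens Y) L) {U : Opens (X × Y)}
    {V : Opens X} {W : Opens Y} (h : box V W ≤ U) : φ V ⊓ ψ W ≤ pairFun φ ψ U :=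
  le_sSup ⟨V, W, h, rfl⟩

theorem pairFun_mono (φ : FrameHom (Opens X) L) (ψ : FrameHom (Opens Y) L)
    {U U' : Opens (X × Y)} (h : U ≤ U') : pairFun φ ψ U ≤ pairFun φ ψ U' := by
  refine sSup_le ?_
  rintro x ⟨V, W, hVW, rfl⟩
  exact le_pairFun φ ψ (hVW.trans h)

theorem pairFun_cover [LocallyCompactSpace X] (φ : FrameHom (Opens X) L)
    (ψ : FrameHom (Opens Y) L) (𝒰 : Set (Opens (X × Y))) (B : L)
    (hB : ∀ U ∈ 𝒰, pairFun φ ψ U ≤ B) (V : Opens X) (W : Opens Y)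
    (hVW : box V W ≤ sSup 𝒰) : φ V ⊓ ψ W ≤ B := by
  have key : ∀ (K : Set X), IsCompact K → K ⊆ V → ∀ y ∈ W,
      ∃ (V₀ : Opens X) (W₀ : Opens Y), K ⊆ V₀ ∧ y ∈ W₀ ∧ φ V₀ ⊓ ψ W₀ ≤ B := by
    intro K hK hKV y hy
    refine hK.induction_on (p := fun S => ∃ (V₀ : Opens X) (W₀ : Opens Y),
      S ⊆ V₀ ∧ y ∈ W₀ ∧ φ V₀ ⊓ ψ W₀ ≤ B) ?_ ?_ ?_ ?_
    · exact ⟨⊥, ⊤, Set.empty_subset _, trivial, by simp⟩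
    · rintro s t hst ⟨V₀, W₀, h1, h2, h3⟩
      exact ⟨V₀, W₀, hst.trans h1, h2, h3⟩
    · rintro s t ⟨V₀, W₀, h1, h2, h3⟩ ⟨V₁, W₁, h4, h5, h6⟩
      refine ⟨V₀ ⊔ V₁, W₀ ⊓ W₁, ?_, ⟨h2, h5⟩, ?_⟩
      · rw [Opens.coe_sup]
        exact Set.union_subset_union h1 h4
      · rw [map_sup, map_inf, inf_sup_right]
        exact sup_le (le_trans (inf_le_inf_left _ inf_le_left) h3)
          (le_trans (inf_le_inf_left _ inf_le_right) h6)
    · intro x hx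
      have hxy : (x, y) ∈ sSup 𝒰 := hVW ⟨hKV hx, hy⟩
      obtain ⟨U, hU, hxyU⟩ := Opens.mem_sSup.1 hxy
      obtain ⟨s, t, hs, ht, hxs, hyt, hst⟩ := isOpen_prod_iff.1 U.2 x y hxyU
      refine ⟨s, mem_nhdsWithin_of_mem_nhds (hs.mem_nhds hxs), ⟨s, hs⟩, ⟨t, ht⟩,
        subset_rfl, hyt, ?_⟩
      exact (le_pairFun φ ψ (V := ⟨s, hs⟩) (W := ⟨t, ht⟩) hst).trans (hB U hU)
  have hV : V = sSup {V' : Opens X | ∃ K : Set X, IsCompact K ∧ K ⊆ V ∧ (V' : Set X) ⊆ K} := by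
    refine le_antisymm ?_ ?_
    · intro x hx
      obtain ⟨K, hK, hxK, hKV⟩ := exists_compact_subset V.2 hx
      exact Opens.mem_sSup.2 ⟨⟨interior K, isOpen_interior⟩, ⟨K, hK, hKV, interior_subset⟩, hxK⟩
    · refine sSup_le ?_
      rintro V' ⟨K, -, h1, h2⟩
      exact h2.trans h1
  rw [hV, map_sSup, sSup_inf_eq]
  refine iSup₂_le ?_
  rintro _ ⟨V', ⟨K, hK, hKV, hV'K⟩, rfl⟩
  have hW : W ≤ sSup {W' : Opens Y | φ V' ⊓ ψ W' ≤ B} := by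
    intro y hy
    obtain ⟨V₀, W₀, h1, h2, h3⟩ := key K hK hKV y hy
    refine Opens.mem_sSup.2 ⟨W₀, ?_, h2⟩
    exact (inf_le_inf_right _ (OrderHomClass.mono φ (hV'K.trans h1))).trans h3
  refine (inf_le_inf_left _ (OrderHomClass.mono ψ hW)).trans ?_
  rw [map_sSup, inf_sSup_eq]
  refine iSup₂_le ?_
  rintro _ ⟨W', hW', rfl⟩
  exact hW'

/-- The homomorphism on the opens of a product induced by homomorphisms on the opens of the
factors. -/
def pair [LocallyCompactSpace X] (φ : FrameHom (Opens X) L) (ψ : FrameHom (Opens Y) L) :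
    FrameHom (Opens (X × Y)) L where
  toFun := pairFun φ ψ
  map_inf' := by
    intro U U'
    refine le_antisymm
      (le_inf (pairFun_mono φ ψ inf_le_left) (pairFun_mono φ ψ inf_le_right)) ?_
    rw [pairFun, pairFun, sSup_inf_sSup]
    refine iSup₂_le ?_
    rintro ⟨x, y⟩ ⟨⟨V, W, hVW, hx⟩, ⟨V', W', hVW', hy⟩⟩
    simp only at hx hy
    subst hx hy
    simp only
    rw [inf_inf_inf_comm, ← map_inf, ← map_inf]
    refine le_pairFun φ ψ ?_
    rintro ⟨a, b⟩ ⟨ha, hb⟩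
    exact ⟨hVW ⟨ha.1, hb.1⟩, hVW' ⟨ha.2, hb.2⟩⟩
  map_top' := by
    refine top_le_iff.1 ?_
    refine le_trans ?_ (le_pairFun φ ψ (U := ⊤) (V := ⊤) (W := ⊤) le_top)
    simp
  map_sSup' := by
    intro 𝒰
    refine le_antisymm ?_ ?_
    · refine sSup_le ?_
      rintro x ⟨V, W, hVW, rfl⟩
      refine pairFun_cover φ ψ 𝒰 _ (fun U hU => ?_) V W hVW
      exact le_sSup ⟨U, hU, rfl⟩
    · refine sSup_le ?_
      rintro x ⟨U, hU, rfl⟩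
      exact pairFun_mono φ ψ (le_sSup hU)

/-- A homomorphism on the opens of a product is determined by its two restrictions. -/
theorem hom_ext_prod {θ θ' : FrameHom (Opens (X × Y)) L}
    (h₁ : θ.comp (Opens.comap ContinuousMap.fst) = θ'.comp (Opens.comap ContinuousMap.fst))
    (h₂ : θ.comp (Opens.comap ContinuousMap.snd) = θ'.comp (Opens.comap ContinuousMap.snd)) :
    θ = θ' := by
  ext U
  have hbox : ∀ (V : Opens X) (W : Opens Y), θ (box V W) = θ' (box V W) := by
    intro V W
    have e : box V W = Opens.comap ContinuousMap.fst V ⊓ Opens.comap ContinuousMap.snd W := rfl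
    rw [e, map_inf, map_inf]
    exact congrArg₂ (· ⊓ ·) (DFunLike.congr_fun h₁ V) (DFunLike.congr_fun h₂ W)
  have hU : U = sSup {U' | ∃ (V : Opens X) (W : Opens Y), box V W ≤ U ∧ U' = box V W} := by
    refine le_antisymm ?_ ?_
    · rintro ⟨x, y⟩ hxy
      obtain ⟨s, t, hs, ht, hxs, hyt, hst⟩ := isOpen_prod_iff.1 U.2 x y hxy
      exact Opens.mem_sSup.2 ⟨_, ⟨⟨s, hs⟩, ⟨t, ht⟩, hst, rfl⟩, ⟨hxs, hyt⟩⟩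
    · refine sSup_le ?_
      rintro _ ⟨V, W, h, rfl⟩
      exact h
  rw [hU, map_sSup, map_sSup]
  congr 1
  refine Set.image_congr ?_
  rintro _ ⟨V, W, -, rfl⟩
  exact hbox V W

theorem pair_fst [LocallyCompactSpace X] (φ : FrameHom (Opens X) L)
    (ψ : FrameHom (Opens Y) L) : (pair φ ψ).comp (Opens.comap ContinuousMap.fst) = φ := by
  ext V
  change pairFun φ ψ _ = φ V
  refine le_antisymm (sSup_le ?_) ?_
  · rintro _ ⟨V', W, h, rfl⟩
    by_cases hW : (W : Set Y).Nonempty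
    · obtain ⟨y, hy⟩ := hW
      refine inf_le_left.trans (OrderHomClass.mono φ ?_)
      intro x hx
      exact h (show (x, y) ∈ box V' W from ⟨hx, hy⟩)
    · have : W = ⊥ := by
        ext y
        simpa using fun hy => hW ⟨y, hy⟩
      rw [this, map_bot, inf_bot_eq]
      exact bot_le
  · have : φ V ⊓ ψ ⊤ ≤ pairFun φ ψ (Opens.comap ContinuousMap.fst V) :=
      le_pairFun φ ψ (fun x hx => hx.1)
    simpa using this

theorem pair_snd [LocallyCompactSpace X] (φ : FrameHom (Opens X) L)
    (ψ : FrameHom (Opens Y) L) : (pair φ ψ).comp (Opens.comap ContinuousMap.snd) = ψ := by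
  ext W
  change pairFun φ ψ _ = ψ W
  refine le_antisymm (sSup_le ?_) ?_
  · rintro _ ⟨V, W', h, rfl⟩
    by_cases hV : (V : Set X).Nonempty
    · obtain ⟨x, hx⟩ := hV
      refine inf_le_right.trans (OrderHomClass.mono ψ ?_)
      intro y hy
      exact h (show (x, y) ∈ box V W' from ⟨hx, hy⟩)
    · have : V = ⊥ := by
        ext x
        simpa using fun hx => hV ⟨x, hx⟩
      rw [this, map_bot, bot_inf_eq]
      exact bot_le
  · have : φ ⊤ ⊓ ψ W ≤ pairFun φ ψ (Opens.comap ContinuousMap.snd W) :=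
      le_pairFun φ ψ (fun x hx => hx.2)
    simpa using this

theorem pair_comap [LocallyCompactSpace X] (θ : FrameHom (Opens Z) L) (f : C(Z, X))
    (g : C(Z, Y)) : pair (θ.comp (Opens.comap f)) (θ.comp (Opens.comap g)) =
      θ.comp (Opens.comap (f.prodMk g)) :=
  hom_ext_prod (by rw [pair_fst]; rfl) (by rw [pair_snd]; rfl)

end Pairing

namespace RealFun

variable {L : Type u} [Order.Frame L]

/-- The operation on `ℛL` given by a continuous binary operation `f` on the reals:
`U` is sent to the join of all `α V ∧ β W` with `f (V × W) ⊆ U`. -/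
def binop (f : C(ℝ × ℝ, ℝ)) (α β : RealFun L) : RealFun L :=
  (pair α β).comp (Opens.comap f)

theorem binop_apply (f : C(ℝ × ℝ, ℝ)) (α β : RealFun L) (U : Opens ℝ) :
    binop f α β U =
      sSup {x | ∃ V W : Opens ℝ, (∀ v ∈ V, ∀ w ∈ W, f (v, w) ∈ U) ∧ x = α V ⊓ β W} := by
  change sSup _ = _
  congr 1
  ext x
  refine exists_congr fun V => exists_congr fun W => and_congr_left fun _ => ?_
  exact ⟨fun h v hv w hw => h (show (v, w) ∈ box V W from ⟨hv, hw⟩),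
    fun h p hp => h p.1 hp.1 p.2 hp.2⟩

/-- The constant function `r`: it sends `U` to `1` if `r ∈ U` and to `0` otherwise. -/
def const (r : ℝ) : RealFun L where
  toFun U := ⨆ _ : r ∈ U, ⊤
  map_inf' := by
    intro U V
    by_cases hU : r ∈ U <;> by_cases hV : r ∈ V <;> simp [hU, hV]
  map_top' := by simp
  map_sSup' := by
    intro 𝒰
    refine le_antisymm (iSup_le fun h => ?_) (sSup_le ?_)
    · obtain ⟨U, hU, hr⟩ := Opens.mem_sSup.1 h
      refine le_trans ?_ (le_sSup ⟨U, hU, rfl⟩)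
      simp [hr]
    · rintro _ ⟨U, hU, rfl⟩
      exact iSup_le fun h => le_iSup_of_le (Opens.mem_sSup.2 ⟨U, hU, h⟩) le_rfl

instance : Zero (RealFun L) := ⟨const 0⟩

instance : One (RealFun L) := ⟨const 1⟩

instance : Add (RealFun L) := ⟨binop ⟨fun x => x.1 + x.2, by fun_prop⟩⟩

instance : Mul (RealFun L) := ⟨binop ⟨fun x => x.1 * x.2, by fun_prop⟩⟩

instance : Neg (RealFun L) := ⟨fun α => α.comp (Opens.comap ⟨fun x => -x, by fun_prop⟩)⟩

variable {Z : Type*} [TopologicalSpace Z]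

theorem comap_add (θ : FrameHom (Opens Z) L) (f g : C(Z, ℝ)) :
    (θ.comp (Opens.comap f) + θ.comp (Opens.comap g) : RealFun L) =
      θ.comp (Opens.comap (f + g)) :=
  congrArg (fun η : FrameHom (Opens (ℝ × ℝ)) L =>
    η.comp (Opens.comap ⟨fun x => x.1 + x.2, by fun_prop⟩)) (pair_comap θ f g)

theorem comap_mul (θ : FrameHom (Opens Z) L) (f g : C(Z, ℝ)) :
    (θ.comp (Opens.comap f) * θ.comp (Opens.comap g) : RealFun L) =
      θ.comp (Opens.comap (f * g)) :=
  congrArg (fun η : FrameHom (Opens (ℝ × ℝ)) L =>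
    η.comp (Opens.comap ⟨fun x => x.1 * x.2, by fun_prop⟩)) (pair_comap θ f g)

theorem comap_neg (θ : FrameHom (Opens Z) L) (f : C(Z, ℝ)) :
    (-(θ.comp (Opens.comap f) : RealFun L)) = θ.comp (Opens.comap (-f)) := rfl

theorem comap_const (θ : FrameHom (Opens Z) L) (r : ℝ) :
    (const r : RealFun L) = θ.comp (Opens.comap (ContinuousMap.const Z r)) := by
  ext U
  change (⨆ _ : r ∈ U, ⊤) = θ (Opens.comap (ContinuousMap.const Z r) U)
  by_cases h : r ∈ U
  · have : Opens.comap (ContinuousMap.const Z r) U = ⊤ := by ext; simpa using h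
    rw [this]; simp [h]
  · have : Opens.comap (ContinuousMap.const Z r) U = ⊥ := by ext; simpa using h
    rw [this]; simp [h]

theorem comap_zero (θ : FrameHom (Opens Z) L) :
    (0 : RealFun L) = θ.comp (Opens.comap (0 : C(Z, ℝ))) := comap_const θ 0

theorem comap_one (θ : FrameHom (Opens Z) L) :
    (1 : RealFun L) = θ.comp (Opens.comap (1 : C(Z, ℝ))) := comap_const θ 1

/-- Any three elements of `ℛL` come from one homomorphism on the opens of `ℝ³`. -/
theorem exists_comap (α β γ : RealFun L) :
    ∃ (θ : FrameHom (Opens (ℝ × ℝ × ℝ)) L) (f g h : C(ℝ × ℝ × ℝ, ℝ)),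
      α = θ.comp (Opens.comap f) ∧ β = θ.comp (Opens.comap g) ∧ γ = θ.comp (Opens.comap h) := by
  refine ⟨pair α (pair β γ), ContinuousMap.fst, ContinuousMap.fst.comp ContinuousMap.snd,
    ContinuousMap.snd.comp ContinuousMap.snd, (pair_fst _ _).symm, ?_, ?_⟩
  · exact ((congrArg (fun η => η.comp (Opens.comap ContinuousMap.fst))
      (pair_snd α (pair β γ))).trans (pair_fst β γ)).symm
  · exact ((congrArg (fun η => η.comp (Opens.comap ContinuousMap.snd))
      (pair_snd α (pair β γ))).trans (pair_snd β γ)).symm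

/-- The commutative ring `ℛL`. -/
instance : CommRing (RealFun L) where
  add_assoc α β γ := by
    obtain ⟨θ, f, g, h, rfl, rfl, rfl⟩ := exists_comap α β γ
    simp only [comap_add, add_assoc]
  zero_add α := by
    obtain ⟨θ, f, g, h, rfl, -, -⟩ := exists_comap α α α
    rw [comap_zero θ, comap_add, zero_add]
  add_zero α := by
    obtain ⟨θ, f, g, h, rfl, -, -⟩ := exists_comap α α α
    rw [comap_zero θ, comap_add, add_zero]
  add_comm α β := by
    obtain ⟨θ, f, g, h, rfl, rfl, -⟩ := exists_comap α β β
    rw [comap_add, comap_add, add_comm]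
  neg_add_cancel α := by
    obtain ⟨θ, f, g, h, rfl, -, -⟩ := exists_comap α α α
    rw [comap_neg, comap_add, comap_zero θ, neg_add_cancel]
  mul_assoc α β γ := by
    obtain ⟨θ, f, g, h, rfl, rfl, rfl⟩ := exists_comap α β γ
    simp only [comap_mul, mul_assoc]
  one_mul α := by
    obtain ⟨θ, f, g, h, rfl, -, -⟩ := exists_comap α α α
    rw [comap_one θ, comap_mul, one_mul]
  mul_one α := by
    obtain ⟨θ, f, g, h, rfl, -, -⟩ := exists_comap α α α
    rw [comap_one θ, comap_mul, mul_one]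
  mul_comm α β := by
    obtain ⟨θ, f, g, h, rfl, rfl, -⟩ := exists_comap α β β
    rw [comap_mul, comap_mul, mul_comm]
  left_distrib α β γ := by
    obtain ⟨θ, f, g, h, rfl, rfl, rfl⟩ := exists_comap α β γ
    simp only [comap_mul, comap_add, mul_add]
  right_distrib α β γ := by
    obtain ⟨θ, f, g, h, rfl, rfl, rfl⟩ := exists_comap α β γ
    simp only [comap_mul, comap_add, add_mul]
  zero_mul α := by
    obtain ⟨θ, f, g, h, rfl, -, -⟩ := exists_comap α α α
    rw [comap_zero θ, comap_mul, zero_mul]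
  mul_zero α := by
    obtain ⟨θ, f, g, h, rfl, -, -⟩ := exists_comap α α α
    rw [comap_zero θ, comap_mul, mul_zero]
  nsmul := nsmulRec
  zsmul := zsmulRec

end RealFun

/-! ### Cozero elements, `P_F`-frames, `z`-ideals -/

section Main

variable {L : Type u} [Order.Frame L]

/-- The cozero map: `coz φ` is the join of all `φ (p, 0) ∨ φ (0, q)` with `p, q` rational. -/
def coz (φ : RealFun L) : L :=
  ⨆ (p : ℚ) (q : ℚ), φ (ioo p 0) ⊔ φ (ioo 0 q)

/-- A cozero element of `L`. -/
def IsCozero (a : L) : Prop := ∃ φ : RealFun L, coz φ = a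

variable (L) in
/-- `L` is a `P_F`-frame: of any two disjoint cozero elements, one is complemented. -/
def IsPFFrame : Prop :=
  ∀ a b : L, IsCozero a → IsCozero b → a ⊓ b = ⊥ → IsComplemented a ∨ IsComplemented b

/-- An ideal of `ℛL` (proper or not) is a `z`-ideal if it contains every element that has the
same cozero element as one of its members. -/
def IsZIdeal (I : Ideal (RealFun L)) : Prop :=
  ∀ α φ : RealFun L, φ ∈ I → coz α = coz φ → α ∈ I

end Main

end PointFree

/-!
Any finitely many elements of `ℛL` are the images of continuous functions under the ring
homomorphism `C(Z, ℝ) →+* ℛL` induced by a frame homomorphism `θ` from the open sets of some `Z`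
to `L`, and an inequality `θ K ≤ θ D` allows one to replace `Z` by the subspace on which `K` implies
`D`. Hence `ℛL` can be treated with pointwise formulas.

If `L` is a `P_F`-frame, the positive and negative parts of `φ² - ψ²` have disjoint cozero
elements, so one of these, say the one where `φ² > ψ²`, is the cozero element of an idempotent `e`.
Then `φ` divides `e`, while `φ² ≤ ψ²` off `e` makes `ψ` divide `(1 - e)φ²`. Two ideals with
elements violating the `z`-ideal property can therefore be played off against each other: `e` goes
to one ideal and `(1 - e)φ²` to the other.

Conversely, let `coz f` and `coz g` be disjoint. The ideals `(f)` and `(g)` have zero intersection,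
and the ideals `(f) + {α | coz α ≤ coz g}` and `(g) + {α | coz α ≤ coz f}` add up to
`{α | coz α ≤ coz f ∨ coz g}`. If one of the ideals in such a pair is a `z`-ideal, then `f` or `g`
divides its own cube root, which forces its cozero element to be complemented.
-/

namespace PointFree

variable {L : Type*} [Order.Frame L] {Z : Type*} [TopologicalSpace Z]

/-! ### Elements of `ℛL` induced by continuous functions -/

section Pullback

/-- The homomorphism from continuous functions on `Z` to `ℛL` induced by a frame homomorphism
`θ` from the open sets of `Z` to `L`. For `Z = ℝⁿ` it is the continuous functional calculus of an
`n`-tuple of elements of `ℛL`. -/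
def pullback (θ : FrameHom (Opens Z) L) : C(Z, ℝ) →+* RealFun L where
  toFun f := θ.comp (Opens.comap f)
  map_zero' := (RealFun.comap_zero θ).symm
  map_one' := (RealFun.comap_one θ).symm
  map_add' f g := (RealFun.comap_add θ f g).symm
  map_mul' f g := (RealFun.comap_mul θ f g).symm

theorem pullback_apply (θ : FrameHom (Opens Z) L) (f : C(Z, ℝ)) (U : Opens ℝ) :
    pullback θ f U = θ (Opens.comap f U) := rfl

theorem pullback_id (φ : RealFun L) : pullback φ (ContinuousMap.id ℝ) = φ := rfl

theorem exists_pullback_eq₂ (α β : RealFun L) :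
    ∃ (θ : FrameHom (Opens (ℝ × ℝ)) L) (f g : C(ℝ × ℝ, ℝ)),
      pullback θ f = α ∧ pullback θ g = β :=
  ⟨pair α β, ContinuousMap.fst, ContinuousMap.snd, pair_fst α β, pair_snd α β⟩

theorem exists_pullback_eq₃ (α β γ : RealFun L) :
    ∃ (θ : FrameHom (Opens (ℝ × ℝ × ℝ)) L) (f g h : C(ℝ × ℝ × ℝ, ℝ)),
      pullback θ f = α ∧ pullback θ g = β ∧ pullback θ h = γ := by
  obtain ⟨θ, f, g, h, rfl, rfl, rfl⟩ := RealFun.exists_comap α β γ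
  exact ⟨θ, f, g, h, rfl, rfl, rfl⟩

theorem exists_comp_comap_subtypeVal (θ : FrameHom (Opens Z) L) (S : Set Z)
    (hS : ∀ U V : Opens Z, (∀ z ∈ S, z ∈ U → z ∈ V) → θ U ≤ θ V) :
    ∃ η : FrameHom (Opens S) L, η.comp (Opens.comap ⟨Subtype.val, continuous_subtype_val⟩) = θ := by
  have exists_extension (W : Opens S) : ∃ U : Opens Z, ∀ z : S, (z : Z) ∈ U ↔ z ∈ W := by
    obtain ⟨U, hU, hUW⟩ := isOpen_induced_iff.1 W.2
    exact ⟨⟨U, hU⟩, Set.ext_iff.1 hUW⟩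
  choose ext mem_ext using exists_extension
  have map_congr (U V : Opens Z) (h : ∀ z : S, (z : Z) ∈ U ↔ (z : Z) ∈ V) : θ U = θ V :=
    le_antisymm (hS U V fun z hz => (h ⟨z, hz⟩).1) (hS V U fun z hz => (h ⟨z, hz⟩).2)
  refine ⟨{ toFun W := θ (ext W), map_inf' W W' := ?_, map_top' := ?_, map_sSup' 𝒲 := ?_ }, ?_⟩
  · rw [← map_inf]
    exact map_congr _ _ fun z =>
      (mem_ext _ z).trans (and_congr (mem_ext W z).symm (mem_ext W' z).symm)
  · rw [← map_top θ]
    exact map_congr _ _ (mem_ext ⊤)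
  · rw [sSup_image, ← map_iSup₂]
    refine map_congr _ _ fun z => ?_
    simp only [mem_ext, Opens.mem_sSup, Opens.mem_iSup, exists_prop]
  · exact FrameHom.ext fun U => map_congr _ _ (mem_ext _)

theorem exists_pullback_restrict_of_le (θ : FrameHom (Opens Z) L) {K D : Opens Z}
    (h : θ K ≤ θ D) :
    ∃ η : FrameHom (Opens {z | z ∈ K → z ∈ D}) L,
      ∀ f : C(Z, ℝ), pullback θ f = pullback η (f.restrict {z | z ∈ K → z ∈ D}) := by
  suffices hS : ∀ U V : Opens Z, (∀ z ∈ {z | z ∈ K → z ∈ D}, z ∈ U → z ∈ V) → θ U ≤ θ V by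
    obtain ⟨η, rfl⟩ := exists_comp_comap_subtypeVal θ _ hS
    exact ⟨η, fun _ => rfl⟩
  intro U V hUV
  have hU : U ≤ V ⊔ U ⊓ K := fun z hz => by
    by_cases hK : z ∈ K
    · exact Or.inr ⟨hz, hK⟩
    · exact Or.inl (hUV z (fun hK' => absurd hK' hK) hz)
  have hUD : U ⊓ D ≤ V := fun z hz => hUV z (fun _ => hz.2) hz.1
  calc θ U ≤ θ (V ⊔ U ⊓ K) := OrderHomClass.mono θ hU
    _ = θ V ⊔ θ U ⊓ θ K := by rw [map_sup, map_inf]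
    _ ≤ θ V ⊔ θ U ⊓ θ D := by gcongr
    _ = θ V ⊔ θ (U ⊓ D) := by rw [map_inf]
    _ ≤ θ V := sup_le le_rfl (OrderHomClass.mono θ hUD)

theorem exists_odd_pow_eq (φ : RealFun L) {n : ℕ} (hn : Odd n) : ∃ c : RealFun L, c ^ n = φ := by
  have tendsto_atBot : Filter.Tendsto (fun x : ℝ => x ^ n) Filter.atBot Filter.atBot := by
    rw [← Filter.tendsto_neg_atTop_iff]
    simpa only [Function.comp_def, hn.neg_pow] using
      (Filter.tendsto_pow_atTop (α := ℝ) hn.pos.ne').comp Filter.tendsto_neg_atBot_atTop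
  let power : ℝ ≃o ℝ := hn.strictMono_pow.orderIsoOfSurjective _
    ((continuous_pow n).surjective (Filter.tendsto_pow_atTop hn.pos.ne') tendsto_atBot)
  let root : C(ℝ, ℝ) := ⟨power.symm, power.symm.continuous⟩
  have root_pow : root ^ n = ContinuousMap.id ℝ := ContinuousMap.ext power.apply_symm_apply
  exact ⟨pullback φ root, by rw [← map_pow, root_pow, pullback_id]⟩

end Pullback

/-! ### Cozero elements -/

section Coz

/-- The open set of nonzero reals, whose value under `φ : RealFun L` is `coz φ`. -/
def nonzero : Opens ℝ := ⟨{0}ᶜ, isOpen_compl_singleton⟩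

theorem mem_nonzero {x : ℝ} : x ∈ nonzero ↔ x ≠ 0 := Iff.rfl

theorem coz_eq_apply_nonzero (φ : RealFun L) : coz φ = φ nonzero := by
  have h : nonzero = ⨆ (p : ℚ) (q : ℚ), ioo p 0 ⊔ ioo 0 q := by
    refine le_antisymm (fun x hx => ?_) (iSup₂_le fun p q => sup_le ?_ ?_)
    · obtain ⟨p, hp⟩ := exists_rat_lt x
      obtain ⟨q, hq⟩ := exists_rat_gt x
      refine Opens.mem_iSup.2 ⟨p, Opens.mem_iSup.2 ⟨q, ?_⟩⟩
      exact (lt_or_gt_of_ne (mem_nonzero.1 hx)).imp (fun h => ⟨hp, h⟩) fun h => ⟨h, hq⟩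
    · exact fun x hx => ne_of_lt hx.2
    · exact fun x hx => ne_of_gt hx.1
  simp only [h, coz, map_iSup, map_sup]

theorem coz_pullback (θ : FrameHom (Opens Z) L) (f : C(Z, ℝ)) :
    coz (pullback θ f) = θ (Opens.comap f nonzero) := coz_eq_apply_nonzero _

theorem coz_pullback_mono (θ : FrameHom (Opens Z) L) {f g : C(Z, ℝ)}
    (h : ∀ z, g z = 0 → f z = 0) : coz (pullback θ f) ≤ coz (pullback θ g) := by
  rw [coz_pullback, coz_pullback]
  exact OrderHomClass.mono θ fun z hz hg => hz (h z hg)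

theorem isCozero_apply (φ : RealFun L) (U : Opens ℝ) : IsCozero (φ U) := by
  obtain ⟨f, hf, hf_contDiff, -⟩ := U.isOpen.exists_contDiff_support_eq (n := 0)
  refine ⟨pullback φ ⟨f, hf_contDiff.continuous⟩, ?_⟩
  rw [coz_pullback]
  exact congrArg φ (Opens.ext hf)

theorem coz_zero : coz (0 : RealFun L) = ⊥ := by
  rw [coz_eq_apply_nonzero]
  exact iSup_neg (not_not.2 rfl)

theorem coz_one : coz (1 : RealFun L) = ⊤ := by
  rw [coz_eq_apply_nonzero]
  exact iSup_pos one_ne_zero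

theorem coz_eq_bot {φ : RealFun L} : coz φ = ⊥ ↔ φ = 0 := by
  refine ⟨fun h => ?_, fun h => h ▸ coz_zero⟩
  rw [coz_eq_apply_nonzero] at h
  obtain ⟨η, hη⟩ := exists_pullback_restrict_of_le φ (K := nonzero) (D := ⊥) (by rw [h, map_bot])
  rw [← pullback_id φ, hη, ← map_zero (pullback η)]
  exact congrArg _ (ContinuousMap.ext fun z => not_not.1 z.2)

theorem coz_mul (α β : RealFun L) : coz (α * β) = coz α ⊓ coz β := by
  obtain ⟨θ, f, g, rfl, rfl⟩ := exists_pullback_eq₂ α β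
  rw [← map_mul, coz_pullback, coz_pullback, coz_pullback, ← map_inf]
  exact congrArg θ (Opens.ext (Set.ext fun z => mul_ne_zero_iff))

theorem coz_pow (α : RealFun L) {n : ℕ} (hn : n ≠ 0) : coz (α ^ n) = coz α := by
  induction n, Nat.one_le_iff_ne_zero.2 hn using Nat.le_induction with
  | base => rw [pow_one]
  | succ n hn' ih => rw [pow_succ, coz_mul, ih (by omega), inf_idem]

theorem coz_add_le (α β : RealFun L) : coz (α + β) ≤ coz α ⊔ coz β := by
  obtain ⟨θ, f, g, rfl, rfl⟩ := exists_pullback_eq₂ α β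
  rw [← map_add, coz_pullback, coz_pullback, coz_pullback, ← map_sup]
  refine OrderHomClass.mono θ fun z (hz : f z + g z ≠ 0) => ?_
  by_cases hf : f z = 0
  · exact Or.inr fun hg : g z = 0 => hz (by rw [hf, hg, add_zero])
  · exact Or.inl hf

theorem coz_sq_add_sq (α β : RealFun L) : coz (α ^ 2 + β ^ 2) = coz α ⊔ coz β := by
  obtain ⟨θ, f, g, rfl, rfl⟩ := exists_pullback_eq₂ α β
  rw [← map_pow, ← map_pow, ← map_add, coz_pullback, coz_pullback, coz_pullback, ← map_sup]
  refine congrArg θ (Opens.ext (Set.ext fun z => ?_))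
  change f z ^ 2 + g z ^ 2 ≠ 0 ↔ f z ≠ 0 ∨ g z ≠ 0
  rw [Ne, add_eq_zero_iff_of_nonneg (sq_nonneg _) (sq_nonneg _), sq_eq_zero_iff, sq_eq_zero_iff,
    not_and_or]

theorem coz_sup_coz_one_sub (φ : RealFun L) : coz φ ⊔ coz (1 - φ) = ⊤ := by
  simpa only [add_sub_cancel, coz_one, top_le_iff] using coz_add_le φ (1 - φ)

theorem coz_le_of_dvd {φ ψ : RealFun L} (h : φ ∣ ψ) : coz ψ ≤ coz φ := by
  obtain ⟨κ, rfl⟩ := h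
  exact (coz_mul φ κ).trans_le inf_le_left

theorem isUnit_of_coz_eq_top {φ : RealFun L} (h : coz φ = ⊤) : IsUnit φ := by
  rw [coz_eq_apply_nonzero] at h
  obtain ⟨η, hη⟩ := exists_pullback_restrict_of_le φ (K := ⊤) (D := nonzero) (by rw [h, map_top])
  have hne (z : {z : ℝ | z ∈ (⊤ : Opens ℝ) → z ∈ nonzero}) : (z : ℝ) ≠ 0 := z.2 trivial
  refine IsUnit.of_mul_eq_one
    (pullback η ⟨fun z => (z : ℝ)⁻¹, continuous_subtype_val.inv₀ hne⟩) ?_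
  nth_rw 1 [← pullback_id φ]
  rw [hη, ← map_mul, ← map_one (pullback η)]
  exact congrArg _ (ContinuousMap.ext fun z => mul_inv_cancel₀ (hne z))

/-- The cozero element of the positive part of `φ`. -/
def cozPos (φ : RealFun L) : L := φ ⟨Set.Ioi 0, isOpen_Ioi⟩

theorem cozPos_inf_cozPos_neg (φ : RealFun L) : cozPos φ ⊓ cozPos (-φ) = ⊥ := by
  rw [← pullback_id φ, ← map_neg, cozPos, cozPos, pullback_apply, pullback_apply, ← map_inf,
    ← map_bot φ]
  refine congrArg φ (eq_bot_iff.2 fun x (hx : 0 < x ∧ 0 < -x) => ?_)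
  linarith [hx.1, hx.2]

theorem cozPos_sq_mul (α β : RealFun L) : cozPos (α ^ 2 * β) = coz α ⊓ cozPos β := by
  obtain ⟨θ, f, g, rfl, rfl⟩ := exists_pullback_eq₂ α β
  rw [← map_pow, ← map_mul, coz_pullback, cozPos, cozPos, pullback_apply, pullback_apply,
    ← map_inf]
  refine congrArg θ (Opens.ext (Set.ext fun z => ?_))
  change 0 < f z ^ 2 * g z ↔ f z ≠ 0 ∧ 0 < g z
  by_cases hf : f z = 0
  · simp [hf]
  · exact (mul_pos_iff_of_pos_left (sq_pos_iff.2 hf)).trans (and_iff_right hf).symm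

theorem cozPos_sq_sub_sq_le (φ ψ : RealFun L) : cozPos (φ ^ 2 - ψ ^ 2) ≤ coz φ := by
  obtain ⟨θ, f, g, rfl, rfl⟩ := exists_pullback_eq₂ φ ψ
  rw [← map_pow, ← map_pow, ← map_sub, coz_pullback, cozPos, pullback_apply]
  refine OrderHomClass.mono θ fun z (hz : 0 < f z ^ 2 - g z ^ 2) => ?_
  exact sq_pos_iff.1 ((sq_nonneg (g z)).trans_lt (sub_pos.1 hz))

end Coz

/-! ### Division in `ℛL` -/

section Division

/-- Here `u z / g z = 0` where `g z = 0`. -/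
theorem continuous_div_of_abs_le_mul {u g k : Z → ℝ} (hu : Continuous u) (hg : Continuous g)
    (hk : Continuous k) (hle : ∀ z, |u z| ≤ |k z| * |g z|) (hzero : ∀ z, g z = 0 → k z = 0) :
    Continuous fun z => u z / g z := by
  refine continuous_iff_continuousAt.2 fun z => ?_
  by_cases hz : g z = 0
  · have hlim : Filter.Tendsto (fun y => |k y|) (nhds z) (nhds 0) := by
      simpa only [hzero z hz, abs_zero] using hk.abs.tendsto z
    rw [ContinuousAt, hz, div_zero]
    refine squeeze_zero_norm (fun y => ?_) hlim
    rw [Real.norm_eq_abs, abs_div]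
    exact div_le_of_le_mul₀ (abs_nonneg _) (abs_nonneg _) (hle y)
  · exact hu.continuousAt.div hg.continuousAt hz

theorem pullback_dvd_pullback_sq (θ : FrameHom (Opens Z) L) {f g : C(Z, ℝ)}
    (hle : ∀ z, f z ^ 2 ≤ g z ^ 2) : pullback θ g ∣ pullback θ f ^ 2 := by
  have hcont : Continuous fun z => f z ^ 2 / g z :=
    continuous_div_of_abs_le_mul (by fun_prop) g.continuous g.continuous
      (fun z => by rw [abs_of_nonneg (sq_nonneg _), abs_mul_abs_self, ← sq]; exact hle z)
      fun _ hz => hz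
  refine ⟨pullback θ ⟨_, hcont⟩, ?_⟩
  rw [← map_pow, ← map_mul]
  refine congrArg _ (ContinuousMap.ext fun z => (mul_div_cancel_of_imp' fun hz => ?_).symm)
  exact le_antisymm ((hle z).trans_eq (by rw [hz, zero_pow two_ne_zero])) (sq_nonneg _)

theorem dvd_sq_of_cozPos_sq_sub_sq_eq_bot {φ ψ : RealFun L} (h : cozPos (φ ^ 2 - ψ ^ 2) = ⊥) :
    ψ ∣ φ ^ 2 := by
  obtain ⟨θ, f, g, rfl, rfl⟩ := exists_pullback_eq₂ φ ψ
  rw [← map_pow, ← map_pow, ← map_sub, cozPos, pullback_apply, ← map_bot θ] at h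
  obtain ⟨η, hη⟩ := exists_pullback_restrict_of_le θ h.le
  rw [hη, hη]
  exact pullback_dvd_pullback_sq η fun z => sub_nonpos.1 (not_lt.1 z.2)

theorem exists_add_of_ne_zero (θ : FrameHom (Opens Z) L) {k f g : C(Z, ℝ)}
    (hk : ∀ z, k z ≠ 0 → f z ≠ 0 ∨ g z ≠ 0) :
    ∃ κ₁ κ₂ : RealFun L, pullback θ k = κ₁ + κ₂ ∧
      coz κ₁ ≤ coz (pullback θ f) ∧ coz κ₂ ≤ coz (pullback θ g) := by
  have hzero (z : Z) (hz : f z ^ 2 + g z ^ 2 = 0) : k z = 0 := by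
    by_contra hkz
    rw [add_eq_zero_iff_of_nonneg (sq_nonneg _) (sq_nonneg _), sq_eq_zero_iff, sq_eq_zero_iff] at hz
    exact (hk z hkz).elim (· hz.1) (· hz.2)
  have hcont (u : C(Z, ℝ)) (hu : ∀ z, u z ^ 2 ≤ f z ^ 2 + g z ^ 2) :
      Continuous fun z => k z * u z ^ 2 / (f z ^ 2 + g z ^ 2) :=
    continuous_div_of_abs_le_mul (by fun_prop) (by fun_prop) k.continuous (fun z => by
      rw [abs_mul, abs_of_nonneg (sq_nonneg (u z))]
      exact mul_le_mul_of_nonneg_left ((hu z).trans (le_abs_self _)) (abs_nonneg _)) hzero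
  refine ⟨pullback θ ⟨_, hcont f fun z => le_add_of_nonneg_right (sq_nonneg _)⟩,
    pullback θ ⟨_, hcont g fun z => le_add_of_nonneg_left (sq_nonneg _)⟩, ?_,
    coz_pullback_mono θ fun z hz => ?_, coz_pullback_mono θ fun z hz => ?_⟩
  · rw [← map_add]
    refine congrArg _ (ContinuousMap.ext fun z => ?_)
    change k z = k z * f z ^ 2 / (f z ^ 2 + g z ^ 2) + k z * g z ^ 2 / (f z ^ 2 + g z ^ 2)
    rw [← add_div, ← mul_add, mul_div_cancel_of_imp (hzero z)]
  all_goals simp [hz]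

theorem exists_add_of_coz_le_sup {κ α β : RealFun L} (h : coz κ ≤ coz α ⊔ coz β) :
    ∃ κ₁ κ₂ : RealFun L, κ = κ₁ + κ₂ ∧ coz κ₁ ≤ coz α ∧ coz κ₂ ≤ coz β := by
  obtain ⟨θ, k, f, g, rfl, rfl, rfl⟩ := exists_pullback_eq₃ κ α β
  rw [coz_pullback, coz_pullback, coz_pullback, ← map_sup] at h
  obtain ⟨η, hη⟩ := exists_pullback_restrict_of_le θ h
  rw [hη, hη, hη]
  exact exists_add_of_ne_zero η fun z => z.2

end Division

/-! ### Idempotents and complemented elements -/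

section Idempotents

/-- The frame homomorphism that is `α` on `c` and `β` on its complement `d`. -/
def glue {M : Type*} [CompleteLattice M] {c d : L} (h : IsCompl c d) (α β : FrameHom M L) :
    FrameHom M L where
  toFun U := c ⊓ α U ⊔ d ⊓ β U
  map_inf' U V := by
    have cross (x y : L) : c ⊓ x ⊓ (d ⊓ y) = ⊥ := by
      rw [inf_inf_inf_comm, h.inf_eq_bot, bot_inf_eq]
    rw [inf_sup_left, inf_sup_right, inf_sup_right, cross, inf_comm (d ⊓ _), cross, sup_bot_eq,
      bot_sup_eq, ← inf_inf_distrib_left, ← inf_inf_distrib_left, map_inf, map_inf]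
  map_top' := by rw [map_top, map_top, inf_top_eq, inf_top_eq, h.sup_eq_top]
  map_sSup' 𝒰 := by
    simp only [map_sSup, sSup_image, inf_iSup_eq, iSup_sup_eq]

theorem pullback_glue {c d : L} (h : IsCompl c d) (α β : FrameHom (Opens Z) L) (f : C(Z, ℝ)) :
    pullback (glue h α β) f = glue h (pullback α f) (pullback β f) := rfl

theorem isIdempotentElem_glue_one_zero {c d : L} (h : IsCompl c d) :
    IsIdempotentElem (glue h 1 0 : RealFun L) :=
  calc (glue h 1 0 * glue h 1 0 : RealFun L)
    _ = pullback (glue h 1 0) (ContinuousMap.id ℝ * ContinuousMap.id ℝ) := by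
      rw [map_mul, pullback_id]
    _ = glue h 1 0 := by
      rw [pullback_glue, map_mul, map_mul, pullback_id, pullback_id, one_mul, zero_mul]

theorem coz_glue_one_zero {c d : L} (h : IsCompl c d) : coz (glue h 1 0 : RealFun L) = c := by
  rw [coz_eq_apply_nonzero]
  change c ⊓ (1 : RealFun L) nonzero ⊔ d ⊓ (0 : RealFun L) nonzero = c
  rw [← coz_eq_apply_nonzero, ← coz_eq_apply_nonzero, coz_one, coz_zero, inf_top_eq, inf_bot_eq,
    sup_bot_eq]

theorem isComplemented_iff_exists_idempotent {c : L} :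
    IsComplemented c ↔ ∃ e : RealFun L, IsIdempotentElem e ∧ coz e = c := by
  constructor
  · rintro ⟨d, h⟩
    exact ⟨glue h 1 0, isIdempotentElem_glue_one_zero h, coz_glue_one_zero h⟩
  · rintro ⟨e, he, rfl⟩
    refine ⟨coz (1 - e), IsCompl.of_eq ?_ (coz_sup_coz_one_sub e)⟩
    rw [← coz_mul, he.mul_one_sub_self, coz_zero]

theorem isComplemented_coz_of_sq_dvd {c : RealFun L} (h : c ^ 2 ∣ c) : IsComplemented (coz c) := by
  obtain ⟨k, hk⟩ := h
  refine isComplemented_iff_exists_idempotent.2 ⟨c * k, ?_, ?_⟩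
  · change c * k * (c * k) = c * k
    linear_combination -k * hk
  · exact le_antisymm (coz_le_of_dvd ⟨k, rfl⟩)
      (coz_le_of_dvd ⟨c, by linear_combination hk⟩)

theorem dvd_of_coz_le {e φ : RealFun L} (he : IsIdempotentElem e) (h : coz e ≤ coz φ) :
    φ ∣ e := by
  have hunit : IsUnit (φ ^ 2 + (1 - e) ^ 2) := by
    apply isUnit_of_coz_eq_top
    rw [coz_sq_add_sq, eq_top_iff, ← coz_sup_coz_one_sub e]
    exact sup_le_sup_right h _
  rw [← hunit.dvd_mul_right]
  exact ⟨e * φ, by linear_combination (e - 1) * he.eq⟩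

theorem exists_idempotent_of_isComplemented_cozPos {φ ψ : RealFun L}
    (h : IsComplemented (cozPos (φ ^ 2 - ψ ^ 2))) :
    ∃ e : RealFun L, IsIdempotentElem e ∧ φ ∣ e ∧ ψ ∣ (1 - e) * φ ^ 2 := by
  obtain ⟨e, he, hcoz⟩ := isComplemented_iff_exists_idempotent.1 h
  refine ⟨e, he, dvd_of_coz_le he (hcoz ▸ cozPos_sq_sub_sq_le φ ψ), ?_⟩
  have hle : cozPos (((1 - e) * φ) ^ 2 - ((1 - e) * ψ) ^ 2) = ⊥ := by
    rw [mul_pow, mul_pow, ← mul_sub, cozPos_sq_mul, ← hcoz, ← coz_mul, he.one_sub_mul_self,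
      coz_zero]
  calc ψ ∣ (1 - e) * ψ := dvd_mul_left _ _
    _ ∣ ((1 - e) * φ) ^ 2 := dvd_sq_of_cozPos_sq_sub_sq_eq_bot hle
    _ = (1 - e) * φ ^ 2 := by rw [mul_pow, sq (1 - e), he.one_sub.eq]

theorem IsPFFrame.exists_idempotent (hL : IsPFFrame L) (φ ψ : RealFun L) :
    ∃ e : RealFun L, IsIdempotentElem e ∧
      (φ ∣ e ∧ ψ ∣ (1 - e) * φ ^ 2 ∨ ψ ∣ e ∧ φ ∣ (1 - e) * ψ ^ 2) := by
  rcases hL _ _ (isCozero_apply _ _) (isCozero_apply _ _)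
    (cozPos_inf_cozPos_neg (φ ^ 2 - ψ ^ 2)) with h | h
  · obtain ⟨e, he, hdvd⟩ := exists_idempotent_of_isComplemented_cozPos h
    exact ⟨e, he, Or.inl hdvd⟩
  · obtain ⟨e, he, hdvd⟩ := exists_idempotent_of_isComplemented_cozPos (neg_sub (φ ^ 2) _ ▸ h)
    exact ⟨e, he, Or.inr hdvd⟩

end Idempotents

/-! ### Sums and intersections that are `z`-ideals -/

section ZIdeals

theorem mem_of_one_sub_mul_mem {R : Type*} [Ring R] {I : Ideal R} [I.IsTwoSided] {e x : R}
    (he : e ∈ I) (h : (1 - e) * x ∈ I) : x ∈ I := by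
  simpa only [sub_mul, one_mul, sub_add_cancel] using I.add_mem h (I.mul_mem_right x he)

variable {I J : Ideal (RealFun L)}

theorem exists_of_not_isZIdeal (h : ¬ IsZIdeal I) : ∃ α, ∃ φ ∈ I, coz α = coz φ ∧ α ∉ I := by
  simpa only [IsZIdeal, not_forall, exists_prop] using h

theorem mem_of_isZIdeal_inf (hz : IsZIdeal (I ⊓ J)) {e α φ ψ : RealFun L} (hφ : φ ∈ I)
    (hψ : ψ ∈ J) (hφe : φ ∣ e) (hψe : ψ ∣ (1 - e) * φ ^ 2) (hα : coz α = coz φ) : α ∈ I := by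
  have hφ_inf : (1 - e) * φ ^ 2 ∈ I ⊓ J :=
    ⟨I.mul_mem_left _ (I.pow_mem_of_mem hφ 2 two_pos), J.mem_of_dvd hψe hψ⟩
  have hcoz : coz ((1 - e) * α) = coz ((1 - e) * φ ^ 2) := by
    rw [coz_mul, coz_mul, coz_pow φ two_ne_zero, hα]
  exact mem_of_one_sub_mul_mem (I.mem_of_dvd hφe hφ) (hz _ _ hφ_inf hcoz).1

theorem IsPFFrame.isZIdeal_of_isZIdeal_inf (hL : IsPFFrame L) (hz : IsZIdeal (I ⊓ J)) :
    IsZIdeal I ∨ IsZIdeal J := by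
  by_contra! hc
  obtain ⟨α, φ, hφ, hα, hαI⟩ := exists_of_not_isZIdeal hc.1
  obtain ⟨β, ψ, hψ, hβ, hβJ⟩ := exists_of_not_isZIdeal hc.2
  obtain ⟨e, -, ⟨hφe, hψe⟩ | ⟨hψe, hφe⟩⟩ := hL.exists_idempotent φ ψ
  · exact hαI (mem_of_isZIdeal_inf hz hφ hψ hφe hψe hα)
  · exact hβJ (mem_of_isZIdeal_inf (inf_comm I J ▸ hz) hψ hφ hψe hφe hβ)

theorem IsPFFrame.exists_mem_and_one_sub_mul_mem (hL : IsPFFrame L) (hz : IsZIdeal (I ⊔ J))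
    {f : RealFun L} (hf : f ∈ I ⊔ J) :
    ∃ e : RealFun L, e ∈ I ∧ (1 - e) * f ∈ J ∨ e ∈ J ∧ (1 - e) * f ∈ I := by
  obtain ⟨c, rfl⟩ := exists_odd_pow_eq f (n := 3) (by decide)
  obtain ⟨i, hi, j, hj, rfl⟩ := Submodule.mem_sup.1 (hz c _ hf (coz_pow c three_ne_zero).symm)
  obtain ⟨e, -, ⟨hie, hje⟩ | ⟨hje, hie⟩⟩ := hL.exists_idempotent i j
  · refine ⟨e, Or.inl ⟨I.mem_of_dvd hie hi, ?_⟩⟩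
    rw [show (1 - e) * (i + j) ^ 3 =
      (i + j) * ((1 - e) * i ^ 2) + (1 - e) * (i + j) * (2 * i + j) * j by ring]
    exact J.add_mem (J.mul_mem_left _ (J.mem_of_dvd hje hj)) (J.mul_mem_left _ hj)
  · refine ⟨e, Or.inr ⟨J.mem_of_dvd hje hj, ?_⟩⟩
    rw [show (1 - e) * (i + j) ^ 3 =
      (i + j) * ((1 - e) * j ^ 2) + (1 - e) * (i + j) * (i + 2 * j) * i by ring]
    exact I.add_mem (I.mul_mem_left _ (I.mem_of_dvd hie hi)) (I.mul_mem_left _ hi)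

theorem IsPFFrame.exists_sq_notMem_of_not_isZIdeal (hL : IsPFFrame L) (hz : IsZIdeal (I ⊔ J))
    (hI : ¬ IsZIdeal I) : ∃ φ ∈ I, ∃ a ∈ J, coz a = coz φ ∧ a ^ 2 ∉ I := by
  obtain ⟨α, φ, hφ, hα, hαI⟩ := exists_of_not_isZIdeal hI
  obtain ⟨a, rfl⟩ := exists_odd_pow_eq α (n := 3) (by decide)
  rw [coz_pow a three_ne_zero] at hα
  have haI : a ^ 2 ∉ I := fun h => hαI (pow_succ' a 2 ▸ I.mul_mem_left a h)
  have hcoz (x : RealFun L) : coz (x * a) = coz (x * φ) := by rw [coz_mul, coz_mul, hα]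
  obtain ⟨e, ⟨heI, haJ⟩ | ⟨heJ, ha⟩⟩ :=
    hL.exists_mem_and_one_sub_mul_mem hz (hz a φ (Ideal.mem_sup_left hφ) hα)
  · refine ⟨(1 - e) * φ, I.mul_mem_left _ hφ, (1 - e) * a, haJ, hcoz _, fun h => haI ?_⟩
    rw [mul_pow, sq (1 - e), mul_assoc] at h
    exact mem_of_one_sub_mul_mem heI (mem_of_one_sub_mul_mem heI h)
  · refine ⟨e * φ, I.mul_mem_left _ hφ, e * a, J.mul_mem_right _ heJ, hcoz _, fun h => haI ?_⟩
    rw [show a ^ 2 = (e * a) ^ 2 + (1 + e) * a * ((1 - e) * a) by ring]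
    exact I.add_mem h (I.mul_mem_left _ ha)

theorem sq_mem_of_dvd_one_sub_mul_sq {e φ a b : RealFun L} (hφ : φ ∈ I) (hb : b ∈ I)
    (ha : coz a = coz φ) (he : IsIdempotentElem e) (hae : a ∣ e) (hbe : b ∣ (1 - e) * a ^ 2) :
    a ^ 2 ∈ I :=
  have hφe : φ ∣ e := dvd_of_coz_le he (ha ▸ coz_le_of_dvd hae)
  mem_of_one_sub_mul_mem (I.mem_of_dvd hφe hφ) (I.mem_of_dvd hbe hb)

theorem IsPFFrame.isZIdeal_of_isZIdeal_sup (hL : IsPFFrame L) (hz : IsZIdeal (I ⊔ J)) :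
    IsZIdeal I ∨ IsZIdeal J := by
  by_contra! hc
  obtain ⟨φ, hφ, a, haJ, ha, haI⟩ := hL.exists_sq_notMem_of_not_isZIdeal hz hc.1
  obtain ⟨ψ, hψ, b, hbI, hb, hbJ⟩ :=
    hL.exists_sq_notMem_of_not_isZIdeal (sup_comm I J ▸ hz) hc.2
  obtain ⟨e, he, ⟨hae, hbe⟩ | ⟨hbe, hae⟩⟩ := hL.exists_idempotent a b
  · exact haI (sq_mem_of_dvd_one_sub_mul_sq hφ hbI ha he hae hbe)
  · exact hbJ (sq_mem_of_dvd_one_sub_mul_sq hψ haJ hb he hbe hae)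

end ZIdeals

/-! ### Ideals attached to elements of the frame -/

section CozIdeals

/-- The ideal of all functions whose cozero element lies below `a`; these supply the `z`-ideals
from which the `P_F`-property is recovered. -/
def cozIdeal (a : L) : Ideal (RealFun L) where
  carrier := {α | coz α ≤ a}
  add_mem' hα hβ := (coz_add_le _ _).trans (sup_le hα hβ)
  zero_mem' := coz_zero.trans_le bot_le
  smul_mem' γ _ hα := (coz_le_of_dvd (dvd_mul_left _ γ)).trans hα

theorem mem_cozIdeal {a : L} {α : RealFun L} : α ∈ cozIdeal a ↔ coz α ≤ a := Iff.rfl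

theorem isZIdeal_cozIdeal (a : L) : IsZIdeal (cozIdeal a) :=
  fun _ _ hφ h => h.trans_le hφ

theorem cozIdeal_bot : cozIdeal (⊥ : L) = ⊥ := by
  ext α
  rw [mem_cozIdeal, le_bot_iff, coz_eq_bot, Ideal.mem_bot]

theorem cozIdeal_mono {a b : L} (h : a ≤ b) : cozIdeal a ≤ cozIdeal b :=
  fun _ hα => le_trans hα h

theorem cozIdeal_inf (a b : L) : cozIdeal (a ⊓ b) = cozIdeal a ⊓ cozIdeal b :=
  Ideal.ext fun _ => le_inf_iff

theorem cozIdeal_coz_sup_coz (f g : RealFun L) :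
    cozIdeal (coz f ⊔ coz g) = cozIdeal (coz f) ⊔ cozIdeal (coz g) := by
  refine le_antisymm (fun κ hκ => ?_)
    (sup_le (cozIdeal_mono le_sup_left) (cozIdeal_mono le_sup_right))
  obtain ⟨κ₁, κ₂, rfl, h₁, h₂⟩ := exists_add_of_coz_le_sup hκ
  exact Submodule.add_mem_sup h₁ h₂

theorem cozIdeal_ne_top {a : L} (h : a ≠ ⊤) : cozIdeal a ≠ ⊤ := by
  rwa [Ne, Ideal.eq_top_iff_one, mem_cozIdeal, coz_one, top_le_iff]

theorem span_singleton_le_cozIdeal (f : RealFun L) : Ideal.span {f} ≤ cozIdeal (coz f) :=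
  (Ideal.span_singleton_le_iff_mem _).2 (mem_cozIdeal.2 le_rfl)

theorem isComplemented_of_isZIdeal_span_sup_cozIdeal {f : RealFun L} {b : L}
    (hfb : coz f ⊓ b = ⊥) (hz : IsZIdeal (Ideal.span {f} ⊔ cozIdeal b)) :
    IsComplemented (coz f) := by
  obtain ⟨c, rfl⟩ := exists_odd_pow_eq f (n := 3) (by decide)
  have hcoz : coz (c ^ 3) = coz c := coz_pow c three_ne_zero
  obtain ⟨x, hx, y, hy, hxy⟩ := Submodule.mem_sup.1
    (hz c _ (Ideal.mem_sup_left (Ideal.mem_span_singleton_self _)) hcoz.symm)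
  have hy_coz : y ∈ cozIdeal (coz (c ^ 3)) := by
    rw [← add_sub_cancel_left x y, hxy]
    exact sub_mem hcoz.ge (span_singleton_le_cozIdeal _ hx)
  have hy_zero : y = 0 := by
    rw [← Ideal.mem_bot, ← cozIdeal_bot, ← hfb, cozIdeal_inf]
    exact ⟨hy_coz, hy⟩
  rw [hy_zero, add_zero] at hxy
  have hdvd : c ^ 3 ∣ c := Ideal.mem_span_singleton.1 (hxy ▸ hx)
  rw [hcoz]
  exact isComplemented_coz_of_sq_dvd ((pow_dvd_pow c (by decide : 2 ≤ 3)).trans hdvd)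

theorem isPFFrame_of_isZIdeal_of_isZIdeal_inf
    (h : ∀ I J : Ideal (RealFun L), IsZIdeal (I ⊓ J) → IsZIdeal I ∨ IsZIdeal J) :
    IsPFFrame L := by
  rintro _ _ ⟨f, rfl⟩ ⟨g, rfl⟩ hfg
  have hbot : Ideal.span {f} ⊓ Ideal.span {g} = cozIdeal (⊥ : L) := by
    rw [cozIdeal_bot, eq_bot_iff, ← cozIdeal_bot, ← hfg, cozIdeal_inf]
    exact inf_le_inf (span_singleton_le_cozIdeal f) (span_singleton_le_cozIdeal g)
  have hcompl (f : RealFun L) (hf : IsZIdeal (Ideal.span {f})) : IsComplemented (coz f) :=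
    isComplemented_of_isZIdeal_span_sup_cozIdeal (inf_bot_eq _) (by rwa [cozIdeal_bot, sup_bot_eq])
  exact (h _ _ (hbot ▸ isZIdeal_cozIdeal ⊥)).imp (hcompl f) (hcompl g)

theorem isPFFrame_of_isZIdeal_of_isZIdeal_sup
    (h : ∀ I J : Ideal (RealFun L), I ⊔ J ≠ ⊤ → IsZIdeal (I ⊔ J) → IsZIdeal I ∨ IsZIdeal J) :
    IsPFFrame L := by
  rintro _ _ ⟨f, rfl⟩ ⟨g, rfl⟩ hfg
  by_cases htop : coz f ⊔ coz g = ⊤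
  · exact Or.inl ⟨coz g, IsCompl.of_eq hfg htop⟩
  have hsum : Ideal.span {f} ⊔ cozIdeal (coz g) ⊔ (Ideal.span {g} ⊔ cozIdeal (coz f)) =
      cozIdeal (coz f ⊔ coz g) := by
    rw [cozIdeal_coz_sup_coz, ← sup_eq_right.2 (span_singleton_le_cozIdeal f),
      ← sup_eq_right.2 (span_singleton_le_cozIdeal g)]
    ac_rfl
  exact (h _ _ (hsum ▸ cozIdeal_ne_top htop) (hsum ▸ isZIdeal_cozIdeal _)).imp
    (isComplemented_of_isZIdeal_span_sup_cozIdeal hfg)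
    (isComplemented_of_isZIdeal_span_sup_cozIdeal (inf_comm (coz f) (coz g) ▸ hfg))

end CozIdeals

end PointFree

open PointFree in
theorem mainTheorem3_general (L : Type*) [Order.Frame L] :
    List.TFAE
      [∀ I J : Ideal (RealFun L), I ⊔ J ≠ ⊤ → IsZIdeal (I ⊔ J) → IsZIdeal I ∨ IsZIdeal J,
       IsPFFrame L,
       ∀ I J : Ideal (RealFun L), IsZIdeal (I ⊓ J) → IsZIdeal I ∨ IsZIdeal J] := by
  tfae_have 1 → 2 := isPFFrame_of_isZIdeal_of_isZIdeal_sup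
  tfae_have 2 → 1 := fun hL _ _ _ hz => hL.isZIdeal_of_isZIdeal_sup hz
  tfae_have 2 → 3 := fun hL _ _ hz => hL.isZIdeal_of_isZIdeal_inf hz
  tfae_have 3 → 2 := isPFFrame_of_isZIdeal_of_isZIdeal_inf
  tfae_finish

theorem mainTheorem3 {L : Type*} [Order.Frame L] (hL : PointFree.IsCompletelyRegular L) :
    List.TFAE
      [∀ I J : Ideal (PointFree.RealFun L), I ⊔ J ≠ ⊤ → PointFree.IsZIdeal (I ⊔ J) →
        PointFree.IsZIdeal I ∨ PointFree.IsZIdeal J,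
       PointFree.IsPFFrame L,
       ∀ I J : Ideal (PointFree.RealFun L), PointFree.IsZIdeal (I ⊓ J) →
        PointFree.IsZIdeal I ∨ PointFree.IsZIdeal J] :=
  mainTheorem3_general L
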